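/- Let $T$ be an infinite, locally finite, spherically homogeneous rooted tree, let $\mathrm{Aut}(T)$ be the group of automorphisms of $T$ fixing the root, and let $\partial T$ be the boundary of $T$ (the space of infinite geodesic rays issued from the root). Let $G\le \mathrm{Aut}(T)$ be a weakly branch group, that is, $G$ acts transitively on each level of $T$ and its action on $\partial T$ is micro-supported: for every non-empty open $U\subseteq\partial T$ some non-trivial element of $G$ fixes $\partial T\setminus U$ pointwise. Let $\mathcal F(\partial T)$ be the compact $G$-space of all closed subsets of $\partial T$ (including $\varnothing$), with the Hausdorff topology, i.e. the topology generated by the sets $\{C : C\cap K=\varnothing\}$ for $K\subseteq \partial T$ compact and $\{C : C\cap U\neq\varnothing\}$ for $U\subseteq\partial T$ open. Let $X$ be a compact Hausdorff space on which $G$ acts minimally by homeomorphisms. Then at least one of the following holds: (i) the action of $G$ on $X$ is not faithful; (ii) the action of $G$ on $X$ is topologically free, i.e. for every $x\in X$ the only element of $G$ that fixes pointwise a neighbourhood of $x$ is the identity; (iii) there exist a closed $G$-invariant subset $F_X\subseteq\mathcal F(\partial T)$ with $|F_X|\ge 2$, on which $G$ acts minimally, and a factor map (a continuous surjective $G$-equivariant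 map) $X\to F_X$. Moreover this $F_X$ is a profinite $G$-space, i.e. it is isomorphic as a $G$-space to an inverse limit of finite discrete $G$-spaces; in particular $X$ factors onto a non-trivial profinite $G$-space. -/

import Mathlib

open Set Topology

namespace WeaklyBranch

/-! ### Dynamical notions for group actions -/

section Dynamics

/-- The germ-stabiliser of `x`: the elements that fix pointwise a neighbourhood of `x`. -/
def germStabilizer (G : Type*) {X : Type*} [Group G] [TopologicalSpace X] [MulAction G X]
    (x : X) : Subgroup G where
  carrier := {g | ∀ᶠ y in 𝓝 x, g • y = y}
  one_mem' := by simp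
  mul_mem' := by
    intro a b ha hb
    filter_upwards [ha, hb] with y h1 h2
    rw [mul_smul, h2, h1]
  inv_mem' := by
    intro a ha
    filter_upwards [ha] with y h1
    exact inv_smul_eq_iff.2 h1.symm

/-- An action is topologically free if all its germ-stabilisers are trivial. -/
def IsTopologicallyFree (G X : Type*) [Group G] [TopologicalSpace X] [MulAction G X] : Prop :=
  ∀ x : X, germStabilizer G x = ⊥

/-- An action is micro-supported if the rigid stabiliser of every non-empty open set, that is,
the pointwise fixator of its complement, is non-trivial. -/
def IsMicroSupported (G X : Type*) [Group G] [TopologicalSpace X] [MulAction G X] : Prop :=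
  ∀ U : Set X, IsOpen U → U.Nonempty → fixingSubgroup G Uᶜ ≠ ⊥

/-- A factor map of `G`-spaces: a continuous, equivariant and surjective map. -/
structure IsFactorMap (G : Type*) {X Y : Type*} [Group G] [TopologicalSpace X] [MulAction G X]
    [TopologicalSpace Y] [MulAction G Y] (π : X → Y) : Prop where
  continuous : Continuous π
  map_smul : ∀ (g : G) (x : X), π (g • x) = g • π x
  surjective : Function.Surjective π

/-- An inverse system of finite `G`-sets indexed by a preorder. -/
structure FiniteInverseSystem (G : Type*) [Group G] (ι : Type*) [Preorder ι] where
  /-- the finite `G`-set at each index -/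
  obj : ι → Type*
  [finite : ∀ i, Finite (obj i)]
  [action : ∀ i, MulAction G (obj i)]
  /-- the transition maps -/
  map : ∀ {i j : ι}, i ≤ j → obj j → obj i
  map_smul : ∀ {i j : ι} (h : i ≤ j) (g : G) (x : obj j), map h (g • x) = g • map h x
  map_refl : ∀ (i : ι) (x : obj i), map (le_refl i) x = x
  map_map : ∀ {i j k : ι} (hij : i ≤ j) (hjk : j ≤ k) (x : obj k),
    map hij (map hjk x) = map (hij.trans hjk) x

attribute [instance] FiniteInverseSystem.finite FiniteInverseSystem.action

/-- The inverse limit: the compatible families. -/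
@[ext]
structure FiniteInverseSystem.Limit {G ι : Type*} [Group G] [Preorder ι]
    (S : FiniteInverseSystem G ι) where
  /-- the coordinates -/
  val : ∀ i, S.obj i
  compatible : ∀ (i j : ι) (h : i ≤ j), S.map h (val j) = val i

/-- The inverse limit carries the topology induced by the product of discrete topologies. -/
instance {G ι : Type*} [Group G] [Preorder ι] (S : FiniteInverseSystem G ι) :
    TopologicalSpace S.Limit :=
  TopologicalSpace.induced FiniteInverseSystem.Limit.val (@Pi.topologicalSpace ι S.obj (fun _ => ⊥))

/-- `G` acts coordinatewise on the inverse limit. -/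
instance {G ι : Type*} [Group G] [Preorder ι] (S : FiniteInverseSystem G ι) :
    MulAction G S.Limit where
  smul g x := ⟨fun i => g • x.val i, fun i j h => by rw [S.map_smul, x.compatible i j h]⟩
  one_smul x := FiniteInverseSystem.Limit.ext (funext fun i => one_smul G (x.val i))
  mul_smul g h x := FiniteInverseSystem.Limit.ext (funext fun i => mul_smul g h (x.val i))

/-- A `G`-space is profinite if it is isomorphic, as a `G`-space, to an inverse limit of finite
(discrete) `G`-spaces over a directed index set. -/
def IsProfiniteGSpace.{u, v} (G : Type v) (Y : Type u) [Group G] [TopologicalSpace Y]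
    [MulAction G Y] : Prop :=
  ∃ (ι : Type u) (_ : Preorder ι) (_ : IsDirectedOrder ι) (_ : Nonempty ι)
    (S : FiniteInverseSystem.{v, u, u} G ι) (e : Y ≃ₜ S.Limit),
    ∀ (g : G) (y : Y), e (g • y) = g • e y

end Dynamics

/-! ### The space of closed subsets -/

section ClosedSubsets

/-- The set of all closed subsets of `Y`, the empty set included. -/
@[ext]
structure ClosedSubsets (Y : Type*) [TopologicalSpace Y] where
  /-- the underlying set -/
  carrier : Set Y
  isClosed : IsClosed carrier

/-- The Hausdorff topology on closed subsets, generated by the conditions `C ∩ K = ∅` with `K`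
compact and `C ∩ U ≠ ∅` with `U` open. -/
instance (Y : Type*) [TopologicalSpace Y] : TopologicalSpace (ClosedSubsets Y) :=
  TopologicalSpace.generateFrom
    ({𝒰 | ∃ K : Set Y, IsCompact K ∧ 𝒰 = {C | C.carrier ∩ K = ∅}} ∪
      {𝒰 | ∃ U : Set Y, IsOpen U ∧ 𝒰 = {C | (C.carrier ∩ U).Nonempty}})

/-- The induced action on closed subsets, `g • C = {g • y | y ∈ C}`. -/
instance (G Y : Type*) [Group G] [TopologicalSpace Y] [MulAction G Y] [ContinuousConstSMul G Y] :
    MulAction G (ClosedSubsets Y) where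
  smul g C := ⟨(fun y => g • y) '' C.carrier, (Homeomorph.smul g).isClosedMap C.carrier C.isClosed⟩
  one_smul C := ClosedSubsets.ext <| by
    change (fun y => (1 : G) • y) '' C.carrier = C.carrier
    simp
  mul_smul g h C := ClosedSubsets.ext <| by
    change (fun y => (g * h) • y) '' C.carrier = (fun y => g • y) '' ((fun y => h • y) '' C.carrier)
    rw [image_image]
    simp only [mul_smul]

end ClosedSubsets

/-! ### Rooted trees -/

section Trees

variable {V : Type*}

/-- The group of automorphisms of the graph `T` that fix the root `o`. -/
def RootedAut (T : SimpleGraph V) (o : V) : Subgroup (T ≃g T) where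
  carrier := {g | g o = o}
  one_mem' := rfl
  mul_mem' := by
    intro a b ha hb
    change a (b o) = o
    rw [show b o = o from hb, show a o = o from ha]
  inv_mem' := by
    intro a ha
    change a.symm o = o
    rw [RelIso.symm_apply_eq]
    exact ha.symm

/-- An automorphism preserves the distance to the root. -/
theorem dist_root_apply {T : SimpleGraph V} {o : V} (g : RootedAut T o) (v : V) :
    T.dist o (g.1 v) = T.dist o v := by
  have key : ∀ (f : T ≃g T) (a b : V), T.Reachable a b → T.dist (f a) (f b) ≤ T.dist a b := by
    intro f a b h
    obtain ⟨p, hp⟩ := h.exists_walk_length_eq_dist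
    rw [← hp, ← SimpleGraph.Walk.length_map f.toHom p]
    exact SimpleGraph.dist_le _
  have ho : g.1 o = o := g.2
  have ho' : g.1.symm o = o := by
    rw [RelIso.symm_apply_eq]
    exact ho.symm
  by_cases h : T.Reachable o v
  · refine le_antisymm ?_ ?_
    · have := key g.1 o v h
      rwa [ho] at this
    · have h' : T.Reachable o (g.1 v) := by
        have := h.map g.1.toHom
        change T.Reachable (g.1 o) (g.1 v) at this
        rwa [ho] at this
      have := key g.1.symm o (g.1 v) h'
      rwa [ho', RelIso.symm_apply_apply] at this
  · have h' : ¬ T.Reachable o (g.1 v) := by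
      intro h'
      apply h
      have := h'.map g.1.symm.toHom
      change T.Reachable (g.1.symm o) (g.1.symm (g.1 v)) at this
      rwa [ho', RelIso.symm_apply_apply] at this
    rw [SimpleGraph.dist_eq_zero_of_not_reachable h, SimpleGraph.dist_eq_zero_of_not_reachable h']

/-- The visual boundary of the rooted tree: infinite geodesic rays issued from the root. -/
@[ext]
structure Boundary (T : SimpleGraph V) (o : V) where
  /-- the successive vertices of the ray -/
  vertex : ℕ → V
  vertex_zero : vertex 0 = o
  adj : ∀ n, T.Adj (vertex n) (vertex (n + 1))
  dist_root : ∀ n, T.dist o (vertex n) = n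

/-- The topology of pointwise convergence of rays, the vertex set being discrete; its basic open
sets are the cylinders, formed by the rays through a given vertex. -/
instance (T : SimpleGraph V) (o : V) : TopologicalSpace (Boundary T o) :=
  TopologicalSpace.induced Boundary.vertex (@Pi.topologicalSpace ℕ (fun _ => V) (fun _ => ⊥))

/-- Rooted automorphisms act on rays vertex by vertex. -/
instance (T : SimpleGraph V) (o : V) : MulAction (RootedAut T o) (Boundary T o) where
  smul g ξ :=
    { vertex := fun n => g.1 (ξ.vertex n)
      vertex_zero := by rw [ξ.vertex_zero]; exact g.2
      adj := fun n => g.1.map_adj_iff.2 (ξ.adj n)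
      dist_root := fun n => (dist_root_apply g _).trans (ξ.dist_root n) }
  one_smul _ := rfl
  mul_smul _ _ _ := rfl

/-- Rooted automorphisms act on the boundary by homeomorphisms. -/
instance (T : SimpleGraph V) (o : V) : ContinuousConstSMul (RootedAut T o) (Boundary T o) where
  continuous_const_smul g := by
    let _ : TopologicalSpace V := ⊥
    have _ : DiscreteTopology V := ⟨rfl⟩
    have hc : Continuous (Boundary.vertex : Boundary T o → ℕ → V) := continuous_induced_dom
    refine continuous_induced_rng.2 ?_
    refine continuous_pi fun n => ?_
    exact (continuous_of_discreteTopology (f := fun v : V => g.1 v)).comp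
      ((continuous_apply n).comp hc)

/-- An infinite, locally finite, spherically homogeneous rooted tree. -/
structure IsSphericallyHomogeneousTree (T : SimpleGraph V) (o : V) : Prop where
  isTree : T.IsTree
  infinite : Infinite V
  locallyFinite : ∀ v, (T.neighborSet v).Finite
  degree_eq : ∀ v w, T.dist o v = T.dist o w → (T.neighborSet v).ncard = (T.neighborSet w).ncard

/-- A weakly branch group: a subgroup of the rooted automorphism group of an infinite locally
finite spherically homogeneous rooted tree that is transitive on every level and whose action on
the boundary is micro-supported. -/
structure IsWeaklyBranch (T : SimpleGraph V) (o : V) (G : Subgroup (RootedAut T o)) : Prop where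
  tree : IsSphericallyHomogeneousTree T o
  level_transitive : ∀ v w, T.dist o v = T.dist o w → ∃ g ∈ G, g.1 v = w
  microSupported : IsMicroSupported G (Boundary T o)

end Trees

end WeaklyBranch

open WeaklyBranch

/-! Assume the action on `X` is faithful and not topologically free. To `x` attach the closed set
`raySupport x` of rays `ξ` such that no cylinder around `ξ` has the second derived subgroup of its
rigid stabiliser inside the stabiliser of `x`. This assignment is equivariant; its image is the
required factor.

Continuity comes from minimality. The points fixed by such second derived subgroups, for the
vertices of one level, form a finite family of closed sets permuted by `G`, and in a minimal space
the members of such a family are open (`isOpen_of_mem_finite_smul_stable`). The same principle,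
applied to the sets of `x` whose support meets a given cylinder, gives the other half of continuity.
The image is profinite because a closed set of rays is determined by the finite sets of vertices it
visits at each level.

Non-triviality is the main point. By `exists_ristDD_le_stabilizer`, a non-trivial element fixing an
open set of `X` forces some stabiliser to contain the second derived subgroup of a rigid stabiliser,
so some support misses some ray. If all supports were equal, they would all miss that ray, and
compactness of `X` would give one non-trivial second derived subgroup acting trivially on `X`,
against faithfulness.

To prove `exists_ristDD_le_stabilizer`, finitely many conjugates of the element have fixed-point
sets covering `X`. They are paired with disjoint open sets of rays that they displace; the rigid
stabilisers of these sets commute, and an induction finds a minimal set for one of them on which its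
conjugate fixes a relatively open piece. A double commutator argument
(`exists_ristDD_le_of_isMinimalSet`) finishes. -/

namespace WeaklyBranch

open scoped Pointwise commutatorElement

/-! ### Rigid stabilisers -/

section RigidStabilizer

variable {G Y : Type*} [Group G] [MulAction G Y]

variable (G) in
/-- The rigid stabiliser of `U`: the elements that fix the complement of `U` pointwise. -/
def rist (U : Set Y) : Subgroup G := fixingSubgroup G Uᶜ

variable (G) in
/-- The second derived subgroup of the rigid stabiliser of `U`. -/
def ristDD (U : Set Y) : Subgroup G := ⁅⁅rist G U, rist G U⁆, ⁅rist G U, rist G U⁆⁆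

theorem mem_rist {U : Set Y} {g : G} : g ∈ rist G U ↔ ∀ y, y ∉ U → g • y = y :=
  mem_fixingSubgroup_iff G

theorem rist_mono {U V : Set Y} (h : U ⊆ V) : rist G U ≤ rist G V :=
  fun _ hg => mem_rist.2 fun y hy => mem_rist.1 hg y fun hu => hy (h hu)

theorem smul_mem_of_mem_rist {U : Set Y} {g : G} (hg : g ∈ rist G U) {y : Y} (hy : y ∈ U) :
    g • y ∈ U := by
  by_contra h
  have h1 := mem_rist.1 (inv_mem hg) _ h
  rw [inv_smul_smul] at h1
  exact h (h1 ▸ hy)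

theorem conj_mem_rist {U : Set Y} {h : G} (hh : h ∈ rist G U) (g : G) :
    g * h * g⁻¹ ∈ rist G (g • U) := by
  refine mem_rist.2 fun y hy => ?_
  rw [mul_smul, mul_smul, mem_rist.1 hh, smul_inv_smul]
  rwa [← mem_smul_set_iff_inv_smul_mem]

variable [FaithfulSMul G Y]

theorem eq_one_of_mem_rist_of_disjoint {U V : Set Y} (hUV : Disjoint U V) {g : G}
    (hU : g ∈ rist G U) (hV : g ∈ rist G V) : g = 1 := by
  refine FaithfulSMul.eq_of_smul_eq_smul (α := Y) fun y => ?_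
  rw [one_smul]
  by_cases hy : y ∈ U
  · exact mem_rist.1 hV y (disjoint_left.1 hUV hy)
  · exact mem_rist.1 hU y hy

theorem commute_of_mem_rist_of_disjoint {U V : Set Y} (hUV : Disjoint U V) {g h : G}
    (hg : g ∈ rist G U) (hh : h ∈ rist G V) : g * h = h * g := by
  refine FaithfulSMul.eq_of_smul_eq_smul (α := Y) fun y => ?_
  rw [mul_smul, mul_smul]
  by_cases hy : y ∈ U
  · rw [mem_rist.1 hh y (disjoint_left.1 hUV hy),
      mem_rist.1 hh _ (disjoint_left.1 hUV (smul_mem_of_mem_rist hg hy))]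
  · rw [mem_rist.1 hg y hy]
    by_cases hy' : y ∈ V
    · exact mem_rist.1 hg _ (disjoint_right.1 hUV (smul_mem_of_mem_rist hh hy'))
    · rw [mem_rist.1 hh y hy', mem_rist.1 hg y hy]

end RigidStabilizer

/-! ### Micro-supported actions and commutators -/

section MicroSupported

variable {G Y : Type*} [Group G] [TopologicalSpace Y] [MulAction G Y]

/-- A point moved by `g` has an open neighbourhood moved off itself by `g`. -/
theorem exists_isOpen_disjoint_smul [ContinuousConstSMul G Y] [T2Space Y] {g : G} {U : Set Y}
    (hU : IsOpen U) {y : Y} (hy : y ∈ U) (hg : g • y ≠ y) : ∃ V ⊆ U, IsOpen V ∧ y ∈ V ∧ Disjoint (g • V) V := by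
  obtain ⟨A, B, hA, hB, hyA, hyB, hAB⟩ := t2_separation hg
  refine ⟨U ∩ B ∩ (fun z => g • z) ⁻¹' A, fun z hz => hz.1.1,
    (hU.inter hB).inter (hA.preimage (continuous_const_smul g)), ⟨⟨hy, hyB⟩, hyA⟩, ?_⟩
  refine disjoint_left.2 ?_
  rintro _ ⟨z, hz, rfl⟩ hz'
  exact disjoint_left.1 hAB hz.2 hz'.1.2

/-- A non-trivial element of a rigid stabiliser moves some open subset off itself. -/
theorem exists_isOpen_disjoint_smul_of_mem_rist [ContinuousConstSMul G Y] [T2Space Y]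
    [FaithfulSMul G Y] {g : G} {U : Set Y} (hU : IsOpen U) (hg : g ∈ rist G U) (h1 : g ≠ 1) :
    ∃ V ⊆ U, IsOpen V ∧ V.Nonempty ∧ Disjoint (g • V) V := by
  have : ∃ y : Y, g • y ≠ y := by
    by_contra! h
    exact h1 (FaithfulSMul.eq_of_smul_eq_smul (α := Y) fun y => by rw [h, one_smul])
  obtain ⟨y, hy⟩ := this
  have hyU : y ∈ U := by
    by_contra h
    exact hy (mem_rist.1 hg y h)
  obtain ⟨V, hVU, hV, hyV, hd⟩ := exists_isOpen_disjoint_smul hU hyU hy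
  exact ⟨V, hVU, hV, ⟨y, hyV⟩, hd⟩

theorem exists_mem_rist_ne_one (hG : IsMicroSupported G Y) {U : Set Y} (hU : IsOpen U)
    (hne : U.Nonempty) : ∃ g ∈ rist G U, g ≠ 1 :=
  (Subgroup.ne_bot_iff_exists_ne_one.1 (hG U hU hne)).elim fun g hg =>
    ⟨g.1, g.2, fun h => hg (Subtype.ext h)⟩

variable [T2Space Y] [FaithfulSMul G Y]

/-- A finite open set in a Hausdorff space has isolated points, and the rigid stabiliser of an
isolated point fixes that point too, so it is trivial by faithfulness. -/
theorem IsMicroSupported.infinite_of_isOpen (hG : IsMicroSupported G Y) {U : Set Y} (hU : IsOpen U)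
    (hne : U.Nonempty) : U.Infinite := by
  intro hfin
  obtain ⟨p, hp⟩ := hne
  have hop : IsOpen ({p} : Set Y) := by
    have : ({p} : Set Y) = U ∩ (U \ {p})ᶜ := by
      ext z
      simp only [mem_singleton_iff, mem_inter_iff, mem_compl_iff, mem_sdiff, not_and, not_not]
      exact ⟨by rintro rfl; exact ⟨hp, fun _ => rfl⟩, fun h => h.2 h.1⟩
    rw [this]
    exact hU.inter (hfin.subset sdiff_subset).isClosed.isOpen_compl
  obtain ⟨g, hg, h1⟩ := exists_mem_rist_ne_one hG hop (singleton_nonempty p)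
  refine h1 (FaithfulSMul.eq_of_smul_eq_smul (α := Y) fun y => ?_)
  rw [one_smul]
  by_cases hy : y ∈ ({p} : Set Y)
  · have := smul_mem_of_mem_rist hg hy
    rw [mem_singleton_iff] at this hy
    rw [this, hy]
  · exact mem_rist.1 hg y hy

theorem exists_disjoint_open_seq (hG : IsMicroSupported G Y) {U : Set Y} (hU : IsOpen U)
    (hne : U.Nonempty) : ∃ V : ℕ → Set Y, (∀ n, V n ⊆ U ∧ IsOpen (V n) ∧ (V n).Nonempty) ∧
      Pairwise fun m n => Disjoint (V m) (V n) := by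
  have : Infinite U := (hG.infinite_of_isOpen hU hne).to_subtype
  obtain ⟨W, hW, hWo, hWd⟩ := exists_seq_infinite_isOpen_pairwise_disjoint U
  refine ⟨fun n => Subtype.val '' W n, fun n => ⟨?_, ?_, ?_⟩, fun m n h => ?_⟩
  · rintro _ ⟨z, -, rfl⟩
    exact z.2
  · exact hU.isOpenMap_subtype_val _ (hWo n)
  · exact (hW n).nonempty.image _
  · exact (disjoint_image_iff Subtype.val_injective).2 (hWd h)

/-- A subgroup of finite relative index in a rigid stabiliser contains the derived subgroup of a
smaller rigid stabiliser. -/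
theorem exists_commutator_rist_le (hG : IsMicroSupported G Y) {U : Set Y} (hU : IsOpen U)
    (hne : U.Nonempty) {Γ : Subgroup G} (hΓ : Γ.relIndex (rist G U) ≠ 0) :
    ∃ V ⊆ U, IsOpen V ∧ V.Nonempty ∧ ⁅rist G V, rist G V⁆ ≤ Γ := by
  obtain ⟨V, hV, hd⟩ := exists_disjoint_open_seq hG hU hne
  set L := rist G U
  have : (Γ.subgroupOf L).FiniteIndex := ⟨hΓ⟩
  set K := (Γ.subgroupOf L).normalCore
  have : Finite (L ⧸ K) := Subgroup.finite_quotient_of_finiteIndex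
  -- A finite group has finitely many subgroups, so two of the commuting groups `rist G (V n)` have
  -- the same image in `L ⧸ K`; that image is therefore abelian.
  obtain ⟨j, l, hjl, he⟩ := Finite.exists_ne_map_eq_of_infinite
    fun n => ((rist G (V n)).subgroupOf L).map (QuotientGroup.mk' K)
  refine ⟨V j, (hV j).1, (hV j).2.1, (hV j).2.2, ?_⟩
  rw [Subgroup.commutator_le]
  intro a ha b hb
  set a' : L := ⟨a, rist_mono (hV j).1 ha⟩
  set b' : L := ⟨b, rist_mono (hV j).1 hb⟩
  have hb' : QuotientGroup.mk' K b' ∈ ((rist G (V l)).subgroupOf L).map (QuotientGroup.mk' K) := by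
    rw [← he]
    exact Subgroup.mem_map_of_mem _ hb
  obtain ⟨c, hc, hcb⟩ := hb'
  have hac : a' * c = c * a' := Subtype.ext
    (commute_of_mem_rist_of_disjoint (hd hjl) ha (Subgroup.mem_subgroupOf.1 hc))
  have : QuotientGroup.mk' K ⁅a', b'⁆ = 1 := by
    rw [map_commutatorElement, ← hcb, ← map_commutatorElement,
      commutatorElement_eq_one_iff_mul_comm.2 hac,
      map_one]
  have hK : ⁅a', b'⁆ ∈ K := (QuotientGroup.eq_one_iff _).1 this
  exact Subgroup.mem_subgroupOf.1 (Subgroup.normalCore_le _ hK)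

/-- If a monotone family of subgroups of rigid stabilisers is non-trivial on non-empty open sets,
then so is the family of derived subgroups. -/
theorem exists_mem_commutator_ne_one [ContinuousConstSMul G Y] {H : Set Y → Subgroup G}
    (hmono : ∀ U, H U ≤ rist G U)
    (hH : ∀ U V : Set Y, V ⊆ U → H V ≤ H U)
    (hne : ∀ U : Set Y, IsOpen U → U.Nonempty → ∃ g ∈ H U, g ≠ 1)
    {U : Set Y} (hU : IsOpen U) (hUne : U.Nonempty) : ∃ g ∈ ⁅H U, H U⁆, g ≠ 1 := by
  obtain ⟨g, hg, h1⟩ := hne U hU hUne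
  obtain ⟨V, hVU, hV, hVne, hd⟩ := exists_isOpen_disjoint_smul_of_mem_rist hU (hmono U hg) h1
  obtain ⟨h, hh, h2⟩ := hne V hV hVne
  -- If `g` and `h` commuted, `h = g * h * g⁻¹` would be supported both in `V` and in the disjoint
  -- set `g • V`.
  refine ⟨⁅g, h⁆, Subgroup.commutator_mem_commutator hg (hH _ _ hVU hh), fun he => h2 ?_⟩
  refine eq_one_of_mem_rist_of_disjoint hd ?_ (hmono _ hh)
  have := conj_mem_rist (hmono _ hh) g
  rwa [commutatorElement_eq_one_iff_mul_comm.1 he, mul_inv_cancel_right] at this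

end MicroSupported

end WeaklyBranch

namespace WeaklyBranch

open scoped Pointwise commutatorElement

section SecondDerived

variable {G Y : Type*} [Group G] [MulAction G Y]

theorem ristDD_mono {U V : Set Y} (h : U ⊆ V) : ristDD G U ≤ ristDD G V :=
  Subgroup.commutator_mono (Subgroup.commutator_mono (rist_mono h) (rist_mono h))
    (Subgroup.commutator_mono (rist_mono h) (rist_mono h))

theorem commutator_rist_le (U : Set Y) : ⁅rist G U, rist G U⁆ ≤ rist G U :=
  Subgroup.commutator_le_self _

variable [TopologicalSpace Y] [ContinuousConstSMul G Y] [T2Space Y] [FaithfulSMul G Y]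

theorem exists_mem_commutator_rist_ne_one (hG : IsMicroSupported G Y) {U : Set Y} (hU : IsOpen U)
    (hne : U.Nonempty) : ∃ g ∈ ⁅rist G U, rist G U⁆, g ≠ 1 :=
  exists_mem_commutator_ne_one (fun _ => le_rfl) (fun _ _ => rist_mono)
    (fun _ => exists_mem_rist_ne_one hG) hU hne

theorem exists_mem_ristDD_ne_one (hG : IsMicroSupported G Y) {U : Set Y} (hU : IsOpen U)
    (hne : U.Nonempty) : ∃ g ∈ ristDD G U, g ≠ 1 :=
  exists_mem_commutator_ne_one (H := fun U => ⁅rist G U, rist G U⁆) commutator_rist_le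
    (fun _ _ h => Subgroup.commutator_mono (rist_mono h) (rist_mono h))
    (fun _ => exists_mem_commutator_rist_ne_one hG) hU hne

end SecondDerived

/-! ### Minimal sets of commuting subgroups -/

section MinimalSets

variable {G X : Type*} [Group G] [TopologicalSpace X] [MulAction G X]

/-- A minimal non-empty closed set for the action of a subgroup `L`. -/
structure IsMinimalSet (L : Subgroup G) (Z : Set X) : Prop where
  isClosed : IsClosed Z
  nonempty : Z.Nonempty
  smul_mem : ∀ a ∈ L, ∀ z ∈ Z, a • z ∈ Z
  exists_smul_mem : ∀ z ∈ Z, ∀ W : Set X, IsOpen W → (Z ∩ W).Nonempty → ∃ a ∈ L, a • z ∈ W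

variable [ContinuousConstSMul G X]

theorem exists_isMinimalSet [CompactSpace X] {L : Subgroup G} {Y : Set X} (hY : IsClosed Y)
    (hne : Y.Nonempty) (hL : ∀ a ∈ L, ∀ y ∈ Y, a • y ∈ Y) : ∃ Z ⊆ Y, IsMinimalSet L Z := by
  obtain ⟨Z, hZY, hZ⟩ := zorn_superset_nonempty
    {Z : Set X | IsClosed Z ∧ Z.Nonempty ∧ ∀ a ∈ L, ∀ z ∈ Z, a • z ∈ Z} (by
      intro c hc hchain hcne
      refine ⟨⋂₀ c, ⟨isClosed_sInter fun s hs => (hc hs).1, ?_, ?_⟩,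
        fun s hs => sInter_subset_of_mem hs⟩
      · have : Nonempty c := hcne.to_subtype
        exact IsCompact.nonempty_sInter_of_directed_nonempty_isCompact_isClosed
          (fun s hs r hr => (hchain.total hs hr).elim (fun h => ⟨s, hs, Subset.rfl, h⟩)
            fun h => ⟨r, hr, h, Subset.rfl⟩) (fun s hs => (hc hs).2.1)
          (fun s hs => (hc hs).1.isCompact) (fun s hs => (hc hs).1)
      · intro a ha z hz s hs
        exact (hc hs).2.2 a ha z (hz s hs)) Y ⟨hY, hne, hL⟩
  refine ⟨Z, hZY, hZ.prop.1, hZ.prop.2.1, hZ.prop.2.2, fun z hz W hW hne => ?_⟩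
  have hsub : closure {y | ∃ a ∈ L, a • z = y} ⊆ Z :=
    closure_minimal (by rintro _ ⟨a, ha, rfl⟩; exact hZ.prop.2.2 a ha z hz) hZ.prop.1
  have hle := hZ.le_of_le (y := closure {y | ∃ a ∈ L, a • z = y})
    ⟨isClosed_closure, ⟨z, subset_closure ⟨1, one_mem L, one_smul _ _⟩⟩, ?_⟩ hsub
  · obtain ⟨w, hwZ, hwW⟩ := hne
    obtain ⟨_, hu, a, ha, rfl⟩ := mem_closure_iff.1 (hle hwZ) W hW hwW
    exact ⟨a, ha, hu⟩
  · intro a ha y hy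
    refine map_mem_closure (continuous_const_smul a) hy ?_
    rintro _ ⟨b, hb, rfl⟩
    exact ⟨a * b, mul_mem ha hb, mul_smul _ _ _⟩

theorem IsMinimalSet.smul {L : Subgroup G} {Z : Set X} (hZ : IsMinimalSet L Z) {b : G}
    (hb : ∀ a ∈ L, a * b = b * a) : IsMinimalSet L (b • Z) where
  isClosed := hZ.isClosed.smul b
  nonempty := hZ.nonempty.smul_set
  smul_mem := by
    rintro a ha _ ⟨z, hz, rfl⟩
    refine ⟨a • z, hZ.smul_mem a ha z hz, ?_⟩
    simp only [smul_smul, hb a ha]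
  exists_smul_mem := by
    rintro _ ⟨z, hz, rfl⟩ W hW ⟨_, ⟨w, hw, rfl⟩, hwW⟩
    obtain ⟨a, ha, haW⟩ := hZ.exists_smul_mem z hz _ (hW.preimage (continuous_const_smul b))
      ⟨w, hw, hwW⟩
    refine ⟨a, ha, ?_⟩
    simpa only [mem_preimage, smul_smul, hb a ha] using haW

/-- The return times of a point of a minimal set to an open set generate a subgroup of finite
index. -/
theorem IsMinimalSet.relIndex_closure_ne_zero [CompactSpace X] {L : Subgroup G} {Z : Set X}
    (hZ : IsMinimalSet L Z) {z : X} (hz : z ∈ Z) {W : Set X} (hW : IsOpen W)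
    (hne : (Z ∩ W).Nonempty) :
    (Subgroup.closure {a | a ∈ L ∧ a • z ∈ W}).relIndex L ≠ 0 := by
  set Δ := Subgroup.closure {a | a ∈ L ∧ a • z ∈ W}
  -- Finitely many translates `l⁻¹ • W` cover `Z`. If `a • z` lies in the one for `l`, then `l * a`
  -- is a return time, so `a` lies in the coset of `l⁻¹`.
  obtain ⟨t, ht⟩ := hZ.isClosed.isCompact.elim_finite_subcover
    (fun l : L => (fun x => (l : G) • x) ⁻¹' W)
    (fun l => hW.preimage (continuous_const_smul _)) (by
      intro x hx
      obtain ⟨a, ha, haW⟩ := hZ.exists_smul_mem x hx W hW hne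
      exact mem_iUnion.2 ⟨⟨a, ha⟩, haW⟩)
  have hfin : Finite (L ⧸ Δ.subgroupOf L) := by
    refine Finite.of_surjective (fun l : t => (QuotientGroup.mk (l.1⁻¹ : L) : L ⧸ Δ.subgroupOf L)) ?_
    intro q
    obtain ⟨a, rfl⟩ := QuotientGroup.mk_surjective q
    obtain ⟨l, hl, hlW⟩ := mem_iUnion₂.1 (ht (hZ.smul_mem a a.2 z hz))
    refine ⟨⟨l, hl⟩, QuotientGroup.eq.2 ?_⟩
    rw [inv_inv]
    refine Subgroup.mem_subgroupOf.2 (Subgroup.subset_closure ⟨(l * a).2, ?_⟩)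
    rw [Subgroup.coe_mul, mul_smul]
    exact hlW
  exact Subgroup.index_ne_zero_of_finite

/-- If finitely many fixed-point sets cover `Y`, one of them has non-empty interior in some
minimal set for the corresponding member of a family of commuting subgroups preserving `Y`. -/
theorem exists_isMinimalSet_subset_fixedBy [CompactSpace X] [T2Space X] {ι : Type*} [DecidableEq ι]
    (g : ι → G) (L : ι → Subgroup G)
    (hL : ∀ i j, i ≠ j → ∀ a ∈ L i, ∀ b ∈ L j, a * b = b * a) (s : Finset ι) :
    ∀ Y : Set X, IsClosed Y → Y.Nonempty → (∀ i ∈ s, ∀ a ∈ L i, ∀ y ∈ Y, a • y ∈ Y) →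
    (∀ y ∈ Y, ∃ i ∈ s, g i • y = y) →
    ∃ i, ∃ Z W : Set X, IsMinimalSet (L i) Z ∧ IsOpen W ∧ (Z ∩ W).Nonempty ∧
      ∀ z ∈ Z ∩ W, g i • z = z := by
  induction s using Finset.induction_on with
  | empty =>
    rintro Y - ⟨y, hy⟩ - h
    obtain ⟨i, hi, -⟩ := h y hy
    simp at hi
  | insert i s his ih =>
    intro Y hY hne hinv hcov
    have hclosed : IsClosed {y : X | ∃ j ∈ s, g j • y = y} := by
      have : {y : X | ∃ j ∈ s, g j • y = y} = ⋃ j ∈ s, {y | g j • y = y} := by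
        ext y
        simp
      rw [this]
      exact isClosed_biUnion_finset fun j _ => isClosed_eq (continuous_const_smul _) continuous_id
    -- Either a minimal set of `L i` leaves the fixed-point sets indexed by `s`, and off these only
    -- `g i` can fix its points, or all minimal sets of `L i` lie inside them and `i` can be
    -- dropped.
    by_cases hcase : ∃ Z ⊆ Y, IsMinimalSet (L i) Z ∧ ¬ Z ⊆ {y | ∃ j ∈ s, g j • y = y}
    · obtain ⟨Z, hZY, hZ, hns⟩ := hcase
      obtain ⟨z, hz, hzn⟩ := not_subset.1 hns
      refine ⟨i, Z, _, hZ, hclosed.isOpen_compl, ⟨z, hz, hzn⟩, ?_⟩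
      rintro w ⟨hwZ, hwn⟩
      obtain ⟨j, hj, hjw⟩ := hcov w (hZY hwZ)
      rcases Finset.mem_insert.1 hj with rfl | hj
      · exact hjw
      · exact absurd ⟨j, hj, hjw⟩ hwn
    · push Not at hcase
      -- The other `L j` commute with `L i`, hence permute its minimal sets in `Y` and preserve the
      -- closure of their union.
      set M : Set X := {y | ∃ Z ⊆ Y, IsMinimalSet (L i) Z ∧ y ∈ Z}
      have hMs : M ⊆ {y | ∃ j ∈ s, g j • y = y} := by
        rintro y ⟨Z, hZY, hZ, hy⟩
        exact hcase Z hZY hZ hy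
      refine ih (closure M) isClosed_closure ?_ ?_ (closure_minimal hMs hclosed)
      · obtain ⟨Z, hZY, hZ⟩ := exists_isMinimalSet hY hne (hinv i (Finset.mem_insert_self _ _))
        exact ⟨_, subset_closure ⟨Z, hZY, hZ, hZ.nonempty.some_mem⟩⟩
      · intro j hj a ha y hy
        refine map_mem_closure (continuous_const_smul a) hy ?_
        rintro x ⟨Z, hZY, hZ, hx⟩
        refine ⟨a • Z, ?_, hZ.smul fun b hb => hL i j (by rintro rfl; exact his hj) b hb a ha,
          smul_mem_smul_set hx⟩
        rintro _ ⟨z, hz, rfl⟩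
        exact hinv j (Finset.mem_insert_of_mem hj) a ha z (hZY hz)

end MinimalSets

/-! ### Large stabilisers from fixed open sets -/

section Stabilizers

variable {G X Y : Type*} [Group G] [TopologicalSpace X] [MulAction G X] [ContinuousConstSMul G X]
  [TopologicalSpace Y] [MulAction G Y] [ContinuousConstSMul G Y] [T2Space Y] [FaithfulSMul G Y]
  [CompactSpace X]

/-- If an element moving `U` off itself fixes a non-empty open subset of a minimal set for the
rigid stabiliser of `U`, then the stabiliser of some point contains the second derived subgroup of
a rigid stabiliser. -/
theorem exists_ristDD_le_of_isMinimalSet (hG : IsMicroSupported G Y) {U : Set Y} (hU : IsOpen U)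
    (hUne : U.Nonempty) {g : G} (hgU : Disjoint (g • U) U) {Z W : Set X}
    (hZ : IsMinimalSet (rist G U) Z) (hW : IsOpen W) (hne : (Z ∩ W).Nonempty)
    (hfix : ∀ z ∈ Z ∩ W, g • z = z) :
    ∃ z : X, ∃ V : Set Y, IsOpen V ∧ V.Nonempty ∧ ristDD G V ≤ MulAction.stabilizer G z := by
  obtain ⟨z, hzZ, hzW⟩ := hne
  set L := rist G U
  set N : Subgroup G := MulAction.stabilizer G z ⊓ L
  -- On return times to `W`, `a` acts as its conjugate by `g`, which is supported in `g • U` and so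
  -- commutes with all of `L`.
  have hq : ∀ a ∈ L, ∀ x ∈ Z, x ∈ W → a • x ∈ W → (g * a * g⁻¹) • x = a • x := by
    intro a ha x hx hxW haW
    rw [mul_smul, mul_smul, inv_smul_eq_iff.2 (hfix x ⟨hx, hxW⟩).symm,
      hfix _ ⟨hZ.smul_mem a ha x hx, haW⟩]
  have hcomm : ∀ a ∈ L, ∀ b ∈ L, (g * a * g⁻¹) * b = b * (g * a * g⁻¹) := fun a ha b hb =>
    commute_of_mem_rist_of_disjoint hgU (conj_mem_rist ha g) hb
  -- For `n` in `N`, `a * n * a⁻¹` fixes `a • z = (g * a * g⁻¹) • z`; since it commutes with `g * a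
  -- * g⁻¹`, it fixes `z`. The converse runs the same way.
  have hnorm : Subgroup.closure {a | a ∈ L ∧ a • z ∈ W} ≤ Subgroup.normalizer (N : Set G) := by
    rw [Subgroup.closure_le]
    rintro a ⟨ha, haW⟩
    have haz := hq a ha z hzZ hzW haW
    refine Subgroup.mem_normalizer_iff.2 fun n => ⟨?_, ?_⟩
    · rintro ⟨hn, hnL⟩
      have hL : a * n * a⁻¹ ∈ L := mul_mem (mul_mem ha hnL) (inv_mem ha)
      refine ⟨?_, hL⟩
      have hn' : n • z = z := hn
      change (a * n * a⁻¹) • z = z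
      have h1 := hcomm a ha _ hL
      have h2 : (a * n * a⁻¹) • (a • z) = a • z := by
        rw [smul_smul, inv_mul_cancel_right, mul_smul, hn']
      rw [← haz, smul_smul, ← h1, mul_smul] at h2
      exact smul_left_cancel _ h2
    · rintro ⟨hn, hnL⟩
      have hL : n ∈ L := by
        have := mul_mem (mul_mem (inv_mem ha) hnL) ha
        group at this
        simpa using this
      refine ⟨?_, hL⟩
      have hn' : (a * n * a⁻¹) • z = z := hn
      change n • z = z
      have h1 := hcomm a ha _ hL
      have h2 : (a * n * a⁻¹) • (g * a * g⁻¹) • z = (g * a * g⁻¹) • z := by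
        rw [smul_smul, ← hcomm a ha _ hnL, mul_smul, hn']
      rw [haz, smul_smul, inv_mul_cancel_right, mul_smul] at h2
      exact smul_left_cancel _ h2
  have hΔ := hZ.relIndex_closure_ne_zero hzZ hW ⟨z, hzZ, hzW⟩
  have hN : ∃ n ∈ N, n ≠ 1 := by
    by_contra! hN
    have hb : ∃ b, b ∈ L ∧ b • z ∈ W ∧ b ≠ 1 := by
      by_contra! hb
      obtain ⟨V, hVU, hV, hVne, hle⟩ := exists_commutator_rist_le hG hU hUne hΔ
      obtain ⟨c, hc, hc1⟩ := exists_mem_commutator_rist_ne_one hG hV hVne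
      refine hc1 ?_
      have : Subgroup.closure {a | a ∈ L ∧ a • z ∈ W} ≤ ⊥ := by
        rw [Subgroup.closure_le]
        rintro a ⟨h1, h2⟩
        exact hb a h1 h2
      exact this (hle hc)
    obtain ⟨b, hbL, hbW, hb1⟩ := hb
    -- Shrinking `W` makes `a`, `b` and `b * a` all subject to `hq`, so that `(b * a) • z = (a * b)
    -- • z`. With `N` trivial, such `a` commute with `b`, yet they generate a subgroup of finite
    -- index in `L`, too large to centralise `b ≠ 1`.
    have hΔ' := hZ.relIndex_closure_ne_zero hzZ (W := W ∩ (fun x => b • x) ⁻¹' W)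
      (hW.inter (hW.preimage (continuous_const_smul b))) ⟨z, hzZ, hzW, hbW⟩
    obtain ⟨V, hVU, hV, hVne, hd⟩ := exists_isOpen_disjoint_smul_of_mem_rist hU hbL hb1
    have hΔV := mt (Subgroup.relIndex_eq_zero_of_le_right (rist_mono (G := G) hVU)) hΔ'
    obtain ⟨V', hVV, hV', hVne', hle⟩ := exists_commutator_rist_le hG hV hVne hΔV
    obtain ⟨c, hc, hc1⟩ := exists_mem_commutator_rist_ne_one hG hV' hVne'
    have hcent : Subgroup.closure {a | a ∈ L ∧ a • z ∈ W ∩ (fun x => b • x) ⁻¹' W} ≤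
        Subgroup.centralizer {b} := by
      rw [Subgroup.closure_le]
      rintro a ⟨ha, haW, hbaW⟩
      have h1 := hq (b * a) (mul_mem hbL ha) z hzZ hzW (by rw [mul_smul]; exact hbaW)
      have h2 : g * (b * a) * g⁻¹ = (g * b * g⁻¹) * (g * a * g⁻¹) := by group
      rw [h2, mul_smul, hq a ha z hzZ hzW haW, smul_smul, hcomm b hbL a ha, mul_smul,
        hq b hbL z hzZ hzW hbW] at h1
      have h3 : (a * b)⁻¹ * (b * a) ∈ N := by
        refine ⟨?_, L.mul_mem (L.inv_mem (L.mul_mem ha hbL)) (L.mul_mem hbL ha)⟩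
        change ((a * b)⁻¹ * (b * a)) • z = z
        rw [mul_smul, ← h1, ← mul_smul a b, inv_smul_smul]
      have h4 := inv_mul_eq_one.1 (hN _ h3)
      exact Subgroup.mem_centralizer_singleton_iff.2 h4
    have hcb := Subgroup.mem_centralizer_singleton_iff.1 (hcent (hle hc))
    have hcV : c ∈ rist G V := rist_mono hVV (commutator_rist_le _ hc)
    refine hc1 (eq_one_of_mem_rist_of_disjoint hd ?_ hcV)
    have := conj_mem_rist hcV b
    rwa [← hcb, mul_inv_cancel_right] at this
  obtain ⟨n, hnN, hn1⟩ := hN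
  obtain ⟨V, hVU, hV, hVne, hd⟩ := exists_isOpen_disjoint_smul_of_mem_rist hU hnN.2 hn1
  have hΔV := mt (Subgroup.relIndex_eq_zero_of_le_right (rist_mono (G := G) hVU)) hΔ
  obtain ⟨V', hVV, hV', hVne', hle⟩ := exists_commutator_rist_le hG hV hVne hΔV
  refine ⟨z, V', hV', hVne', ?_⟩
  suffices h : ristDD G V' ≤ N from h.trans inf_le_left
  refine Subgroup.commutator_le.2 fun a ha b hb => ?_
  have haN := hnorm (hle ha)
  have hbN := hnorm (hle hb)
  have hc : a * n * a⁻¹ * n⁻¹ ∈ N :=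
    mul_mem ((Subgroup.mem_normalizer_iff.1 haN n).1 hnN) (inv_mem hnN)
  have hd' : b * (a * n * a⁻¹ * n⁻¹)⁻¹ * b⁻¹ ∈ N :=
    (Subgroup.mem_normalizer_iff.1 hbN _).1 (inv_mem hc)
  have hcV : ∀ {c}, c ∈ ⁅rist G V', rist G V'⁆ → c ∈ rist G V := fun hc =>
    rist_mono hVV (commutator_rist_le _ hc)
  have hcb := commute_of_mem_rist_of_disjoint hd (conj_mem_rist (hcV ha) n) (hcV hb)
  -- This is `⁅a, b⁆ = ⁅⁅a, n⁆, b⁆`, valid because `n * a * n⁻¹` commutes with `b`. Since `a` and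
  -- `b` normalise `N`, the right side is in `N`.
  have key : ⁅a, b⁆ = (a * n * a⁻¹ * n⁻¹) * (b * (a * n * a⁻¹ * n⁻¹)⁻¹ * b⁻¹) := by
    have h1 : (a * n * a⁻¹ * n⁻¹) * (b * (a * n * a⁻¹ * n⁻¹)⁻¹ * b⁻¹) =
        a * ((n * a * n⁻¹)⁻¹ * (b * (n * a * n⁻¹))) * a⁻¹ * b⁻¹ := by group
    rw [h1, ← hcb, inv_mul_cancel_left, commutatorElement_def]
  rw [key]
  exact mul_mem hc hd'

/-- If a non-trivial element fixes a non-empty open subset of a minimal compact `G`-space, then the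
stabiliser of some point contains the second derived subgroup of a rigid stabiliser. -/
theorem exists_ristDD_le_stabilizer [T2Space X] [MulAction.IsMinimal G X]
    (hG : IsMicroSupported G Y) {g : G} (hg : g ≠ 1) {W : Set X} (hW : IsOpen W)
    (hWne : W.Nonempty) (hfix : ∀ x ∈ W, g • x = x) :
    ∃ z : X, ∃ V : Set Y, IsOpen V ∧ V.Nonempty ∧ ristDD G V ≤ MulAction.stabilizer G z := by
  classical
  obtain ⟨I, hI⟩ := isCompact_univ.exists_finite_cover_smul (G := G) hW hWne
  have hmoved : ∀ i : I, {y : Y | (i.1 * g * i.1⁻¹) • y ≠ y}.Infinite := by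
    intro i
    refine hG.infinite_of_isOpen (isOpen_ne_fun (continuous_const_smul _) continuous_id) ?_
    by_contra h
    rw [not_nonempty_iff_eq_empty, eq_empty_iff_forall_notMem] at h
    refine hg ?_
    have h1 : i.1 * g * i.1⁻¹ = 1 := FaithfulSMul.eq_of_smul_eq_smul (α := Y) fun y => by
      rw [one_smul]
      exact not_not.1 (h y)
    simpa using h1
  -- Each conjugate moves infinitely many rays; keeping `Fintype.card I` of them makes Hall's
  -- condition hold trivially and yields distinct moved points `p i`.
  choose t ht htc using fun i : I => (hmoved i).exists_subset_card_eq (Fintype.card I)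
  obtain ⟨p, hpinj, hp⟩ := (Finset.all_card_le_biUnion_card_iff_exists_injective t).1 (by
    intro s
    rcases s.eq_empty_or_nonempty with rfl | ⟨i, hi⟩
    · simp
    · calc s.card ≤ Fintype.card I := Finset.card_le_univ s
        _ = (t i).card := (htc i).symm
        _ ≤ _ := Finset.card_le_card (Finset.subset_biUnion_of_mem t hi))
  obtain ⟨A, hA, hAd⟩ := (finite_range p).t2_separation
  have hU : ∀ i : I, ∃ V ⊆ A (p i), IsOpen V ∧ p i ∈ V ∧ Disjoint ((i.1 * g * i.1⁻¹) • V) V :=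
    fun i => exists_isOpen_disjoint_smul (hA _).2 (hA _).1 (ht i (hp i))
  choose V hVA hV hpV hVd using hU
  have hVV : ∀ i j, i ≠ j → Disjoint (V i) (V j) := fun i j hij =>
    (hAd ⟨i, rfl⟩ ⟨j, rfl⟩ fun h => hij (hpinj h)).mono (hVA i) (hVA j)
  obtain ⟨w, hw⟩ := hWne
  obtain ⟨i, Z, W', hZ, hW', hne, hfix'⟩ := exists_isMinimalSet_subset_fixedBy (X := X)
    (fun i : I => i.1 * g * i.1⁻¹) (fun i => rist G (V i))
    (fun i j hij a ha b hb => commute_of_mem_rist_of_disjoint (hVV i j hij) ha hb)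
    Finset.univ univ isClosed_univ ⟨w, mem_univ w⟩ (fun _ _ _ _ _ _ => mem_univ _) (by
      intro y hy
      obtain ⟨i, hi, x, hx, rfl⟩ := mem_iUnion₂.1 (hI hy)
      refine ⟨⟨i, hi⟩, Finset.mem_univ _, ?_⟩
      change (i * g * i⁻¹) • (i • x) = i • x
      rw [smul_smul, inv_mul_cancel_right, mul_smul, hfix x hx])
  exact exists_ristDD_le_of_isMinimalSet hG (hV i) ⟨_, hpV i⟩ (hVd i) hZ hW' hne hfix'

end Stabilizers

end WeaklyBranch

namespace WeaklyBranch

open scoped Pointwise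

/-! ### The rooted tree and its boundary -/

section RootedTrees

variable {V : Type*} {T : SimpleGraph V} {o : V}

theorem parent_unique (hT : T.IsTree) {u u' w : V} (hu : T.Adj u w) (hu' : T.Adj u' w)
    (hd : T.dist o w = T.dist o u + 1) (hd' : T.dist o w = T.dist o u' + 1) : u = u' := by
  obtain ⟨p, hp⟩ := hT.connected.exists_walk_length_eq_dist o u
  obtain ⟨p', hp'⟩ := hT.connected.exists_walk_length_eq_dist o u'
  have h1 : (p.concat hu).IsPath := SimpleGraph.Walk.isPath_of_length_eq_dist _ (by
    rw [SimpleGraph.Walk.length_concat, hp, hd])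
  have h2 : (p'.concat hu').IsPath := SimpleGraph.Walk.isPath_of_length_eq_dist _ (by
    rw [SimpleGraph.Walk.length_concat, hp', hd'])
  have h3 : p.concat hu = p'.concat hu' :=
    congrArg Subtype.val ((hT.isAcyclic.subsingleton_path o w).elim ⟨_, h1⟩ ⟨_, h2⟩)
  have h4 := congrArg SimpleGraph.Walk.penultimate h3
  rwa [SimpleGraph.Walk.penultimate_concat, SimpleGraph.Walk.penultimate_concat] at h4

theorem exists_parent (hT : T.IsTree) {w : V} {n : ℕ} (hw : T.dist o w = n + 1) :
    ∃ u, T.Adj u w ∧ T.dist o u = n := by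
  obtain ⟨p, hp⟩ := hT.connected.exists_walk_length_eq_dist o w
  have hnil : ¬ p.Nil := by
    rw [← SimpleGraph.Walk.length_eq_zero_iff]
    omega
  refine ⟨p.penultimate, p.adj_penultimate hnil, ?_⟩
  have h1 : T.dist o p.penultimate ≤ n := by
    refine (SimpleGraph.dist_le p.dropLast).trans ?_
    rw [SimpleGraph.Walk.length_dropLast]
    omega
  rcases hT.dist_eq_dist_add_one_of_adj o (p.adj_penultimate hnil) with h | h <;> omega

theorem finite_level (hT : IsSphericallyHomogeneousTree T o) (n : ℕ) :
    {v | T.dist o v = n}.Finite := by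
  induction n with
  | zero =>
    refine (finite_singleton o).subset fun v hv => ?_
    exact (hT.isTree.connected.dist_eq_zero_iff.1 hv).symm
  | succ n ih =>
    refine (ih.biUnion fun u _ => hT.locallyFinite u).subset fun v hv => ?_
    obtain ⟨u, huv, hu⟩ := exists_parent hT.isTree hv
    exact mem_iUnion₂.2 ⟨u, hu, huv⟩

theorem level_nonempty (hT : IsSphericallyHomogeneousTree T o) (n : ℕ) :
    ∃ v, T.dist o v = n := by
  by_contra! h
  have hlt : ∀ k v, T.dist o v ≠ n + k := by
    intro k
    induction k with
    | zero => exact h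
    | succ k ih =>
      intro v hv
      obtain ⟨u, -, hu⟩ := exists_parent hT.isTree hv
      exact ih u hu
  have := hT.infinite
  refine infinite_univ (α := V) (((finite_Iio n).biUnion fun k _ => finite_level hT k).subset ?_)
  intro v _
  refine mem_iUnion₂.2 ⟨T.dist o v, ?_, rfl⟩
  by_contra hv
  rw [mem_Iio, not_lt] at hv
  exact hlt (T.dist o v - n) v (by omega)

/-- The rays whose `n`-th vertex is `v`. -/
def cyl (T : SimpleGraph V) (o : V) (n : ℕ) (v : V) : Set (Boundary T o) := {ξ | ξ.vertex n = v}

theorem isClopen_cyl (n : ℕ) (v : V) : IsClopen (cyl T o n v) := by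
  let _ : TopologicalSpace V := ⊥
  have _ : DiscreteTopology V := ⟨rfl⟩
  have hc : Continuous (Boundary.vertex : Boundary T o → ℕ → V) := continuous_induced_dom
  exact (isClopen_discrete {v}).preimage ((continuous_apply n).comp hc)

theorem Boundary.vertex_eq_of_le (hT : T.IsTree) {ξ η : Boundary T o} {m n : ℕ} (hmn : m ≤ n)
    (h : ξ.vertex n = η.vertex n) : ξ.vertex m = η.vertex m := by
  induction n, hmn using Nat.le_induction with
  | base => exact h
  | succ n _ ih =>
    refine ih (parent_unique (o := o) (w := ξ.vertex (n + 1)) hT (ξ.adj n) (h ▸ η.adj n) ?_ ?_)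
    · rw [ξ.dist_root, ξ.dist_root]
    · rw [ξ.dist_root, η.dist_root]

theorem cyl_anti (hT : T.IsTree) (ξ : Boundary T o) {m n : ℕ} (hmn : m ≤ n) :
    cyl T o n (ξ.vertex n) ⊆ cyl T o m (ξ.vertex m) :=
  fun _ hη => Boundary.vertex_eq_of_le hT hmn hη

theorem exists_cyl_subset (hT : T.IsTree) {U : Set (Boundary T o)} (hU : IsOpen U)
    {ξ : Boundary T o} (hξ : ξ ∈ U) : ∃ n, cyl T o n (ξ.vertex n) ⊆ U := by
  let _ : TopologicalSpace V := ⊥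
  obtain ⟨W, hW, rfl⟩ := isOpen_induced_iff.1 hU
  obtain ⟨I, u, hu, hsub⟩ := isOpen_pi_iff.1 hW _ hξ
  -- The basic neighbourhood constrains only the coordinates in `I`, and agreement at the largest
  -- one forces agreement at all earlier ones.
  refine ⟨I.sup id, fun η hη => hsub fun i hi => ?_⟩
  have h : η.vertex i = ξ.vertex i :=
    Boundary.vertex_eq_of_le hT (Finset.le_sup (f := id) (Finset.mem_coe.1 hi)) hη
  rw [h]
  exact (hu i hi).2

instance : T2Space (Boundary T o) := by
  let _ : TopologicalSpace V := ⊥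
  have _ : DiscreteTopology V := ⟨rfl⟩
  have hc : Continuous (Boundary.vertex : Boundary T o → ℕ → V) := continuous_induced_dom
  exact T2Space.of_injective_continuous (fun ξ η h => Boundary.ext h) hc

theorem compactSpace_boundary (hT : IsSphericallyHomogeneousTree T o) :
    CompactSpace (Boundary T o) := by
  let _ : TopologicalSpace V := ⊥
  have _ : DiscreteTopology V := ⟨rfl⟩
  have hi : IsInducing (Boundary.vertex : Boundary T o → ℕ → V) := ⟨rfl⟩
  refine ⟨hi.isCompact_iff.2 ?_⟩
  refine (isCompact_univ_pi fun n => (finite_level hT n).isCompact).of_isClosed_subset ?_ ?_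
  · have : Boundary.vertex '' (univ : Set (Boundary T o)) =
        {f | f 0 = o} ∩ ⋂ n, ({f | T.Adj (f n) (f (n + 1))} ∩ {f | T.dist o (f n) = n}) := by
      ext f
      constructor
      · rintro ⟨ξ, -, rfl⟩
        exact ⟨ξ.vertex_zero, mem_iInter.2 fun n => ⟨ξ.adj n, ξ.dist_root n⟩⟩
      · rintro ⟨h0, h⟩
        rw [mem_iInter] at h
        exact ⟨⟨f, h0, fun n => (h n).1, fun n => (h n).2⟩, mem_univ _, rfl⟩
    rw [this]
    have hev : ∀ (n : ℕ) (s : Set V), IsClosed {f : ℕ → V | f n ∈ s} := fun n s =>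
      (isClosed_discrete s).preimage (continuous_apply n)
    refine (hev 0 {o}).inter (isClosed_iInter fun n => IsClosed.inter ?_ (hev n {v | T.dist o v = n}))
    have hp : Continuous fun f : ℕ → V => (f n, f (n + 1)) :=
      (continuous_apply n).prodMk (continuous_apply (n + 1))
    exact (isClosed_discrete {p : V × V | T.Adj p.1 p.2}).preimage hp
  · rintro _ ⟨ξ, -, rfl⟩ n -
    exact ξ.dist_root n

variable {G : Subgroup (RootedAut T o)}

theorem vertex_smul (g : G) (ξ : Boundary T o) (n : ℕ) :
    (g • ξ).vertex n = g.1.1 (ξ.vertex n) := rfl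

theorem smul_cyl (g : G) (n : ℕ) (v : V) : g • cyl T o n v = cyl T o n (g.1.1 v) := by
  ext ξ
  rw [mem_smul_set_iff_inv_smul_mem]
  change g.1.1.symm (ξ.vertex n) = v ↔ ξ.vertex n = g.1.1 v
  rw [RelIso.symm_apply_eq]

/-- Every level is non-empty, so some vertex at each level has a child; level transitivity then
gives every vertex a child, and moves a ray from the root onto one through `v`. -/
theorem exists_vertex_eq (hT : IsSphericallyHomogeneousTree T o)
    (hG : ∀ v w, T.dist o v = T.dist o w → ∃ g ∈ G, g.1 v = w) (v : V) :
    ∃ ξ : Boundary T o, ξ.vertex (T.dist o v) = v := by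
  have hchild : ∀ v, ∃ w, T.Adj v w ∧ T.dist o w = T.dist o v + 1 := by
    intro v
    obtain ⟨w, hw⟩ := level_nonempty hT (T.dist o v + 1)
    obtain ⟨u, huw, hu⟩ := exists_parent hT.isTree hw
    obtain ⟨g, -, hg⟩ := hG u v hu
    refine ⟨g.1 w, ?_, (dist_root_apply g w).trans hw⟩
    rw [← hg]
    exact g.1.map_adj_iff.2 huw
  choose c hc hcd using hchild
  let ξ : Boundary T o :=
    { vertex := fun n => c^[n] o
      vertex_zero := rfl
      adj := fun n => by
        rw [Function.iterate_succ_apply']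
        exact hc _
      dist_root := fun n => by
        induction n with
        | zero => simp
        | succ n ih => rw [Function.iterate_succ_apply', hcd, ih] }
  obtain ⟨g, -, hg⟩ := hG (ξ.vertex (T.dist o v)) v (ξ.dist_root _)
  exact ⟨g • ξ, hg⟩

theorem faithfulSMul_boundary (hT : IsSphericallyHomogeneousTree T o)
    (hG : ∀ v w, T.dist o v = T.dist o w → ∃ g ∈ G, g.1 v = w) :
    FaithfulSMul G (Boundary T o) := by
  refine ⟨fun {g h} hgh => Subtype.ext (Subtype.ext (RelIso.ext fun v => ?_))⟩
  obtain ⟨ξ, hξ⟩ := exists_vertex_eq hT hG v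
  have := congrArg (fun η => η.vertex (T.dist o v)) (hgh ξ)
  simp only [vertex_smul, hξ] at this
  exact this

end RootedTrees

end WeaklyBranch

namespace WeaklyBranch

open scoped Pointwise

/-! ### Finite stable families in minimal spaces -/

section FiniteFamilies

variable {G X : Type*} [Group G] [TopologicalSpace X] [MulAction G X]

/-- In a minimal `G`-space, the members of a finite `G`-stable family of closed sets are open. -/
theorem isOpen_of_mem_finite_smul_stable [MulAction.IsMinimal G X] {E : Set (Set X)}
    (hfin : E.Finite) (hclosed : ∀ A ∈ E, IsClosed A) (hsmul : ∀ g : G, ∀ A ∈ E, g • A ∈ E)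
    {A : Set X} (hA : A ∈ E) : IsOpen A := by
  rcases isEmpty_or_nonempty X with hX | hX
  · rw [eq_empty_of_isEmpty A]
    exact isOpen_empty
  set S : X → Set (Set X) := fun x => {B ∈ E | x ∈ B}
  have hSfin : ∀ x, (S x).Finite := fun x => hfin.subset fun B hB => hB.1
  -- Closedness makes `S` upper semicontinuous, and its cardinality is invariant. The locus of
  -- minimal cardinality is thus open and invariant, hence everything, so `S` is locally constant.
  have hnear : ∀ x, ∀ᶠ y in 𝓝 x, S y ⊆ S x := by
    intro x
    have ho : IsOpen (⋂ B ∈ {B ∈ E | x ∉ B}, Bᶜ) :=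
      (hfin.subset fun B hB => hB.1).isOpen_biInter fun B hB => (hclosed B hB.1).isOpen_compl
    filter_upwards [ho.mem_nhds (mem_iInter₂.2 fun B hB => hB.2)] with y hy B hB
    refine ⟨hB.1, ?_⟩
    by_contra hx
    exact mem_iInter₂.1 hy B ⟨hB.1, hx⟩ hB.2
  have hcard : ∀ (g : G) (x : X), (S (g • x)).ncard = (S x).ncard := by
    intro g x
    have : S (g • x) = (fun B => g • B) '' S x := by
      ext B
      constructor
      · rintro ⟨hB, hx⟩
        exact ⟨g⁻¹ • B, ⟨hsmul _ _ hB, mem_inv_smul_set_iff.2 hx⟩, smul_inv_smul g B⟩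
      · rintro ⟨B, ⟨hB, hx⟩, rfl⟩
        exact ⟨hsmul _ _ hB, smul_mem_smul_set hx⟩
    rw [this, ncard_image_of_injective _ (MulAction.injective g)]
  set x₀ := Function.argmin fun x => (S x).ncard
  have hmin : ∀ x, (S x₀).ncard ≤ (S x).ncard := fun x => Function.argmin_le (fun x => (S x).ncard) x
  have hO : IsOpen {x | (S x).ncard = (S x₀).ncard} := by
    refine isOpen_iff_mem_nhds.2 fun x hx => ?_
    filter_upwards [hnear x] with y hy
    exact le_antisymm ((ncard_le_ncard hy (hSfin x)).trans hx.le) (hmin y)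
  have hconst : ∀ x, (S x).ncard = (S x₀).ncard := by
    intro x
    obtain ⟨g, hg⟩ := hO.exists_smul_mem G x ⟨x₀, rfl⟩
    rw [← hcard g x]
    exact hg
  refine isOpen_iff_mem_nhds.2 fun x hx => ?_
  filter_upwards [hnear x] with y hy
  have : S y = S x := eq_of_subset_of_ncard_le hy ((hconst x).trans (hconst y).symm).le (hSfin x)
  have hAx : A ∈ S x := ⟨hA, hx⟩
  rw [← this] at hAx
  exact hAx.2

end FiniteFamilies

/-! ### A criterion for profiniteness -/

section Profinite

universe u v

/-- A compact `G`-space with a decreasing sequence of invariant equivalence relations that have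
finitely many classes, all open, and that separate points, is profinite. -/
theorem isProfiniteGSpace_of_setoid {G : Type v} {Y : Type u} [Group G] [TopologicalSpace Y]
    [CompactSpace Y] [MulAction G Y] (r : ℕ → Setoid Y)
    (hanti : ∀ m n, m ≤ n → ∀ x y, r n x y → r m x y)
    (hsmul : ∀ n (g : G) x y, r n x y → r n (g • x) (g • y))
    (hfin : ∀ n, Finite (Quotient (r n))) (hopen : ∀ n y, IsOpen {z | r n z y})
    (hsep : ∀ x y, (∀ n, r n x y) → x = y) : IsProfiniteGSpace G Y := by
  let _ (n : ℕ) : MulAction G (Quotient (r n)) :=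
    { smul := fun g => Quotient.map (fun x => g • x) fun x y h => hsmul n g x y h
      one_smul := by
        rintro ⟨x⟩
        exact congrArg (Quotient.mk (r n)) (one_smul G x)
      mul_smul := by
        rintro g h ⟨x⟩
        exact congrArg (Quotient.mk (r n)) (mul_smul g h x) }
  let S : FiniteInverseSystem.{v, u, u} G (ULift.{u} ℕ) :=
    { obj := fun i => Quotient (r i.down)
      map := fun {i j} h => Quotient.map id fun x y hxy => hanti i.down j.down h x y hxy
      map_smul := by
        rintro i j h g ⟨x⟩
        rfl
      map_refl := by
        rintro i ⟨x⟩
        rfl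
      map_map := by
        rintro i j k hij hjk ⟨x⟩
        rfl }
  let _ (i : ULift.{u} ℕ) : TopologicalSpace (S.obj i) := ⊥
  have _ (i : ULift.{u} ℕ) : DiscreteTopology (S.obj i) := ⟨rfl⟩
  have hval : Continuous (FiniteInverseSystem.Limit.val : S.Limit → ∀ i, S.obj i) :=
    continuous_induced_dom
  have hT2 : T2Space S.Limit :=
    T2Space.of_injective_continuous (fun a b h => FiniteInverseSystem.Limit.ext h) hval
  let q : ∀ i : ULift.{u} ℕ, Y → S.obj i := fun i y => Quotient.mk (r i.down) y
  have hq : ∀ i, Continuous (q i) := by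
    intro i
    refine continuous_discrete_rng.2 fun b => ?_
    obtain ⟨y, rfl⟩ := Quotient.exists_rep b
    convert hopen i.down y using 1
    ext z
    exact Quotient.eq
  let f : Y → S.Limit := fun y => ⟨fun i => q i y, fun i j h => rfl⟩
  have hf : Continuous f := continuous_induced_rng.2 (continuous_pi hq)
  have hinj : Function.Injective f := by
    intro x y h
    refine hsep x y fun n => ?_
    have := congrFun (congrArg FiniteInverseSystem.Limit.val h) ⟨n⟩
    exact Quotient.exact this
  have hsurj : Function.Surjective f := by
    intro l
    have hcl : ∀ n, IsClosed {y | q ⟨n⟩ y = l.val ⟨n⟩} := fun n =>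
      isClosed_eq (hq _) continuous_const
    -- The fibres over the coordinates of `l` are non-empty, compact and decreasing.
    obtain ⟨y, hy⟩ := IsCompact.nonempty_iInter_of_sequence_nonempty_isCompact_isClosed
      (fun n => {y | q ⟨n⟩ y = l.val ⟨n⟩}) (fun n y hy => by
        have h := l.compatible ⟨n⟩ ⟨n + 1⟩ (Nat.le_succ n)
        rw [← show q ⟨n + 1⟩ y = l.val ⟨n + 1⟩ from hy] at h
        exact h)
      (fun n => Quotient.exists_rep (l.val ⟨n⟩)) (hcl 0).isCompact hcl
    exact ⟨y, FiniteInverseSystem.Limit.ext (funext fun i => mem_iInter.1 hy i.down)⟩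
  exact ⟨ULift.{u} ℕ, inferInstance, inferInstance, inferInstance, S,
    Continuous.homeoOfEquivCompactToT2 (f := Equiv.ofBijective f ⟨hinj, hsurj⟩) hf,
    fun g y => rfl⟩

end Profinite

/-! ### Closed subsets of the boundary -/

section Hyperspace

theorem isOpen_setOf_inter_nonempty {Y : Type*} [TopologicalSpace Y] {U : Set Y} (hU : IsOpen U) :
    IsOpen {C : ClosedSubsets Y | (C.carrier ∩ U).Nonempty} :=
  TopologicalSpace.isOpen_generateFrom_of_mem (Or.inr ⟨U, hU, rfl⟩)

theorem isOpen_setOf_inter_eq_empty {Y : Type*} [TopologicalSpace Y] {K : Set Y}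
    (hK : IsCompact K) : IsOpen {C : ClosedSubsets Y | C.carrier ∩ K = ∅} :=
  TopologicalSpace.isOpen_generateFrom_of_mem (Or.inl ⟨K, hK, rfl⟩)

theorem isClopen_setOf_inter_nonempty {Y : Type*} [TopologicalSpace Y] {K : Set Y}
    (hK : IsCompact K) (hK' : IsOpen K) :
    IsClopen {C : ClosedSubsets Y | (C.carrier ∩ K).Nonempty} := by
  refine ⟨⟨?_⟩, isOpen_setOf_inter_nonempty hK'⟩
  convert isOpen_setOf_inter_eq_empty hK using 1
  ext C
  exact not_nonempty_iff_eq_empty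

variable {V : Type*} {T : SimpleGraph V} {o : V}

/-- The vertices at level `n` through which some ray of `C` passes. -/
def shadow (n : ℕ) (C : ClosedSubsets (Boundary T o)) : Set V :=
  {v | (C.carrier ∩ cyl T o n v).Nonempty}

theorem shadow_subset (n : ℕ) (C : ClosedSubsets (Boundary T o)) :
    shadow n C ⊆ {v | T.dist o v = n} := by
  rintro _ ⟨ξ, -, rfl⟩
  exact ξ.dist_root n

theorem shadow_anti (hT : T.IsTree) {m n : ℕ} (hmn : m ≤ n) {C D : ClosedSubsets (Boundary T o)}
    (h : shadow n C = shadow n D) : shadow m C = shadow m D := by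
  have key : ∀ C D : ClosedSubsets (Boundary T o), shadow n C = shadow n D →
      shadow m C ⊆ shadow m D := by
    rintro C D h _ ⟨ξ, hξ, rfl⟩
    have hm : ξ.vertex n ∈ shadow n C := ⟨ξ, hξ, rfl⟩
    rw [h] at hm
    obtain ⟨η, hη, hηξ⟩ := hm
    exact ⟨η, hη, Boundary.vertex_eq_of_le hT hmn hηξ⟩
  exact (key C D h).antisymm (key D C h.symm)

theorem shadow_smul {G : Subgroup (RootedAut T o)} (g : G) (n : ℕ)
    (C : ClosedSubsets (Boundary T o)) : shadow n (g • C) = g.1.1 '' shadow n C := by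
  ext v
  constructor
  · rintro ⟨_, ⟨ξ, hξ, rfl⟩, rfl⟩
    exact ⟨ξ.vertex n, ⟨ξ, hξ, rfl⟩, rfl⟩
  · rintro ⟨_, ⟨ξ, hξ, rfl⟩, rfl⟩
    exact ⟨g • ξ, ⟨ξ, hξ, rfl⟩, rfl⟩

theorem eq_of_shadow_eq (hT : T.IsTree) {C D : ClosedSubsets (Boundary T o)}
    (h : ∀ n, shadow n C = shadow n D) : C = D := by
  have key : ∀ C D : ClosedSubsets (Boundary T o), (∀ n, shadow n C = shadow n D) →
      C.carrier ⊆ D.carrier := by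
    intro C D h ξ hξ
    by_contra hD
    obtain ⟨n, hn⟩ := exists_cyl_subset hT D.isClosed.isOpen_compl hD
    have hm : ξ.vertex n ∈ shadow n C := ⟨ξ, hξ, rfl⟩
    rw [h] at hm
    obtain ⟨η, hη, hηξ⟩ := hm
    exact hn hηξ hη
  exact ClosedSubsets.ext ((key C D h).antisymm (key D C fun n => (h n).symm))

theorem isClopen_setOf_mem_shadow [CompactSpace (Boundary T o)] (n : ℕ) (v : V) :
    IsClopen {C : ClosedSubsets (Boundary T o) | v ∈ shadow n C} :=
  isClopen_setOf_inter_nonempty (isClopen_cyl n v).isClosed.isCompact (isClopen_cyl n v).isOpen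

/-- Level `n` is finite, and visiting a given vertex is a clopen condition on `C` because cylinders
are compact and open. -/
theorem isOpen_setOf_shadow_eq (hT : IsSphericallyHomogeneousTree T o) (n : ℕ)
    (D : ClosedSubsets (Boundary T o)) :
    IsOpen {C : ClosedSubsets (Boundary T o) | shadow n C = shadow n D} := by
  have := compactSpace_boundary hT
  have : {C : ClosedSubsets (Boundary T o) | shadow n C = shadow n D} =
      ⋂ v ∈ {v | T.dist o v = n}, {C | v ∈ shadow n C ↔ v ∈ shadow n D} := by
    ext C
    simp only [mem_ofPred_eq, mem_iInter, Set.ext_iff]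
    refine ⟨fun h v _ => h v, fun h v => ?_⟩
    by_cases hv : T.dist o v = n
    · exact h v hv
    · exact ⟨fun h' => absurd (shadow_subset n C h') hv, fun h' => absurd (shadow_subset n D h') hv⟩
  rw [this]
  refine (finite_level hT n).isOpen_biInter fun v _ => ?_
  by_cases hv : v ∈ shadow n D
  · simpa only [hv, iff_true] using (isClopen_setOf_mem_shadow n v).isOpen
  · simp only [hv, iff_false]
    exact (isClopen_setOf_mem_shadow n v).compl.isOpen

theorem t2Space_closedSubsets (hT : IsSphericallyHomogeneousTree T o) :
    T2Space (ClosedSubsets (Boundary T o)) := by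
  refine ⟨fun C D hCD => ?_⟩
  have : ∃ n, shadow n C ≠ shadow n D := by
    by_contra! h
    exact hCD (eq_of_shadow_eq hT.isTree h)
  obtain ⟨n, hn⟩ := this
  refine ⟨_, _, isOpen_setOf_shadow_eq hT n C, isOpen_setOf_shadow_eq hT n D, rfl, rfl, ?_⟩
  exact disjoint_left.2 fun E hE hE' => hn (hE.symm.trans hE')

/-- Compact invariant sets of closed subsets of the boundary are profinite. -/
theorem isProfiniteGSpace_closedSubsets (hT : IsSphericallyHomogeneousTree T o)
    {G : Subgroup (RootedAut T o)} (F : SubMulAction G (ClosedSubsets (Boundary T o)))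
    (hF : IsCompact (F : Set (ClosedSubsets (Boundary T o)))) : IsProfiniteGSpace G F := by
  have : CompactSpace F := isCompact_iff_compactSpace.1 hF
  refine isProfiniteGSpace_of_setoid (fun n => Setoid.ker fun C : F => shadow n C.1)
    (fun m n hmn C D h => shadow_anti hT.isTree hmn h) (fun n g C D h => ?_) (fun n => ?_)
    (fun n D => (isOpen_setOf_shadow_eq hT n D.1).preimage continuous_subtype_val)
    fun C D h => Subtype.ext (eq_of_shadow_eq hT.isTree h)
  · change shadow n (g • C.1) = shadow n (g • D.1)
    rw [shadow_smul, shadow_smul, show shadow n C.1 = shadow n D.1 from h]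
  · have hfin : (range fun C : F => shadow n C.1).Finite :=
      (finite_level hT n).finite_subsets.subset (by
        rintro _ ⟨C, rfl⟩
        exact shadow_subset n C.1)
    have := hfin.to_subtype
    exact Finite.of_equiv _ (Setoid.quotientKerEquivRange _).symm

end Hyperspace

end WeaklyBranch

namespace WeaklyBranch

open scoped Pointwise

theorem conj_mem_ristDD {G Y : Type*} [Group G] [MulAction G Y] {U : Set Y} {h : G}
    (hh : h ∈ ristDD G U) (g : G) : g * h * g⁻¹ ∈ ristDD G (g • U) := by
  have hle : (rist G U).map (MulAut.conj g).toMonoidHom ≤ rist G (g • U) := by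
    rintro _ ⟨k, hk, rfl⟩
    exact conj_mem_rist hk g
  have hmap : (ristDD G U).map (MulAut.conj g).toMonoidHom ≤ ristDD G (g • U) := by
    rw [ristDD, Subgroup.map_commutator, Subgroup.map_commutator]
    exact Subgroup.commutator_mono (Subgroup.commutator_mono hle hle)
      (Subgroup.commutator_mono hle hle)
  exact hmap (Subgroup.mem_map_of_mem _ hh)

/-! ### The support map and its continuity -/

section SupportSet

variable {V : Type*} {T : SimpleGraph V} {o : V} {G : Subgroup (RootedAut T o)} {X : Type*}
  [MulAction G X]

variable (G X) in
/-- The points of `X` fixed by the second derived subgroup of the rigid stabiliser of the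
cylinder of `v` at level `n`. -/
def fixedByRistDD (n : ℕ) (v : V) : Set X :=
  {x | ristDD G (cyl T o n v) ≤ MulAction.stabilizer G x}

/-- The rays none of whose cylinders has the second derived subgroup of its rigid stabiliser
contained in the stabiliser of `x`. -/
def raySupport (x : X) : Set (Boundary T o) := {ξ | ∀ n, x ∉ fixedByRistDD G X n (ξ.vertex n)}

theorem smul_mem_fixedByRistDD {n : ℕ} {v : V} {x : X} (g : G) (hx : x ∈ fixedByRistDD G X n v) :
    g • x ∈ fixedByRistDD G X n (g.1.1 v) := by
  intro h hh
  have h1 := conj_mem_ristDD hh g⁻¹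
  rw [← smul_cyl, inv_smul_smul, inv_inv] at h1
  have h2 : (g⁻¹ * h * g) • x = x := hx h1
  change h • g • x = g • x
  rw [← inv_smul_eq_iff, smul_smul, smul_smul, h2]

theorem smul_mem_raySupport {x : X} (g : G) {ξ : Boundary T o} (hξ : ξ ∈ raySupport (G := G) x) :
    g • ξ ∈ raySupport (G := G) (g • x) := by
  intro n hn
  refine hξ n ?_
  have h := smul_mem_fixedByRistDD g⁻¹ hn
  rw [inv_smul_smul] at h
  have h1 : (g⁻¹).1.1 ((g • ξ).vertex n) = ξ.vertex n := g.1.1.symm_apply_apply _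
  rwa [h1] at h

theorem isClosed_raySupport (x : X) : IsClosed (raySupport (G := G) x) := by
  refine ⟨isOpen_iff_mem_nhds.2 fun ξ hξ => ?_⟩
  simp only [raySupport, mem_compl_iff, mem_ofPred_eq, not_forall, not_not] at hξ
  obtain ⟨n, hn⟩ := hξ
  filter_upwards [(isClopen_cyl n (ξ.vertex n)).isOpen.mem_nhds rfl] with η hη h
  exact h n ((show η.vertex n = ξ.vertex n from hη) ▸ hn)

variable (G) in
/-- The set `raySupport x` as a point of the space of closed subsets. -/
def raySupportClosed (x : X) : ClosedSubsets (Boundary T o) :=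
  ⟨raySupport (G := G) x, isClosed_raySupport x⟩

theorem raySupportClosed_smul (g : G) (x : X) :
    raySupportClosed G (g • x) = g • raySupportClosed G x := by
  refine ClosedSubsets.ext (Subset.antisymm ?_ ?_)
  · intro ξ hξ
    refine ⟨g⁻¹ • ξ, ?_, smul_inv_smul g ξ⟩
    have := smul_mem_raySupport g⁻¹ hξ
    rwa [inv_smul_smul] at this
  · rintro _ ⟨ξ, hξ, rfl⟩
    exact smul_mem_raySupport g hξ

variable (G X) in
/-- The set of all ray supports, as a `G`-invariant set of closed subsets. -/
def raySupportSpace : SubMulAction G (ClosedSubsets (Boundary T o)) where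
  carrier := range (raySupportClosed G : X → ClosedSubsets (Boundary T o))
  smul_mem' := by
    rintro g _ ⟨x, rfl⟩
    exact ⟨g • x, raySupportClosed_smul g x⟩

variable [TopologicalSpace X] [MulAction.IsMinimal G X]

/-- Equivariance and finiteness of the level turn the sets `E v` into a finite `G`-stable family of
closed sets. This is how minimality of `X` enters the continuity proof. -/
theorem isOpen_of_level_equivariant (hT : IsSphericallyHomogeneousTree T o) {n : ℕ}
    (E : V → Set X) (hE : ∀ v, T.dist o v = n → IsClosed (E v))
    (hsmul : ∀ (g : G) v x, x ∈ E v → g • x ∈ E (g.1.1 v)) {v : V} (hv : T.dist o v = n) :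
    IsOpen (E v) := by
  refine isOpen_of_mem_finite_smul_stable (G := G) (E := E '' {v | T.dist o v = n})
    ((finite_level hT n).image E) ?_ ?_ ⟨v, hv, rfl⟩
  · rintro _ ⟨w, hw, rfl⟩
    exact hE w hw
  · rintro g _ ⟨w, hw, rfl⟩
    refine ⟨g.1.1 w, (dist_root_apply g.1 w).trans hw, Subset.antisymm ?_ ?_⟩
    · intro x hx
      rw [mem_smul_set_iff_inv_smul_mem]
      have := hsmul g⁻¹ _ _ hx
      rwa [show (g⁻¹).1.1 (g.1.1 w) = w from g.1.1.symm_apply_apply _] at this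
    · rintro _ ⟨x, hx, rfl⟩
      exact hsmul g _ _ hx

variable [T2Space X] [ContinuousConstSMul G X]

theorem isClopen_fixedByRistDD (hT : IsSphericallyHomogeneousTree T o) (n : ℕ) (v : V)
    (hv : T.dist o v = n) : IsClopen (fixedByRistDD (T := T) (o := o) G X n v) := by
  have hclosed : ∀ w, IsClosed (fixedByRistDD (T := T) (o := o) G X n w) := by
    intro w
    have : fixedByRistDD (T := T) (o := o) G X n w =
        ⋂ h ∈ ristDD G (cyl T o n w), {x | h • x = x} := by
      ext x
      simp only [mem_iInter]
      rfl
    rw [this]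
    exact isClosed_biInter fun h _ => isClosed_eq (continuous_const_smul h) continuous_id
  exact ⟨hclosed v, isOpen_of_level_equivariant hT _ (fun w _ => hclosed w)
    (fun g w x hx => smul_mem_fixedByRistDD g hx) hv⟩

theorem isOpen_setOf_raySupport_inter_eq_empty (hT : IsSphericallyHomogeneousTree T o)
    {K : Set (Boundary T o)} (hK : IsCompact K) :
    IsOpen {x : X | raySupport (G := G) x ∩ K = ∅} := by
  refine isOpen_iff_mem_nhds.2 fun x hx => ?_
  -- A ray of `K` is outside the support of `x` exactly when one of these cylinders contains it.
  -- Finitely many suffice, and the corresponding fixing conditions persist near `x`.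
  have hcov : K ⊆ ⋃ p : {p : ℕ × V // T.dist o p.2 = p.1 ∧ x ∈ fixedByRistDD G X p.1 p.2},
      cyl T o p.1.1 p.1.2 := by
    intro ξ hξ
    by_contra h
    refine (eq_empty_iff_forall_notMem.1 hx) ξ ⟨fun n hn => h ?_, hξ⟩
    exact mem_iUnion.2 ⟨⟨(n, ξ.vertex n), ξ.dist_root n, hn⟩, rfl⟩
  obtain ⟨t, ht⟩ := hK.elim_finite_subcover _ (fun p => (isClopen_cyl _ _).isOpen) hcov
  have hnhds : (⋂ p ∈ t, fixedByRistDD (T := T) (o := o) G X p.1.1 p.1.2) ∈ 𝓝 x :=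
    (isOpen_biInter_finset fun p _ => (isClopen_fixedByRistDD hT _ _ p.2.1).isOpen).mem_nhds
      (mem_iInter₂.2 fun p _ => p.2.2)
  filter_upwards [hnhds] with y hy
  refine eq_empty_iff_forall_notMem.2 ?_
  rintro ξ ⟨hξ, hξK⟩
  obtain ⟨p, hp, hξp⟩ := mem_iUnion₂.1 (ht hξK)
  refine hξ p.1.1 ?_
  rw [show ξ.vertex p.1.1 = p.1.2 from hξp]
  exact mem_iInter₂.1 hy p hp

theorem isOpen_setOf_raySupport_inter_nonempty (hT : IsSphericallyHomogeneousTree T o)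
    {U : Set (Boundary T o)} (hU : IsOpen U) :
    IsOpen {x : X | (raySupport (G := G) x ∩ U).Nonempty} := by
  have := compactSpace_boundary hT
  have hcyl : ∀ n v, T.dist o v = n →
      IsOpen {x : X | (raySupport (G := G) x ∩ cyl T o n v).Nonempty} := by
    intro n v hv
    refine isOpen_of_level_equivariant (G := G) hT
      (fun v => {x : X | (raySupport (G := G) x ∩ cyl T o n v).Nonempty}) (fun w _ => ⟨?_⟩) ?_ hv
    -- A cylinder is compact, so missing it is an open condition and meeting it a closed one.
    · convert isOpen_setOf_raySupport_inter_eq_empty (X := X) (G := G) hT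
        (isClopen_cyl n w).isClosed.isCompact using 1
      ext x
      exact not_nonempty_iff_eq_empty
    · rintro g w x ⟨ξ, hξ, rfl⟩
      exact ⟨g • ξ, smul_mem_raySupport g hξ, rfl⟩
  refine isOpen_iff_mem_nhds.2 ?_
  rintro x ⟨ξ, hξ, hξU⟩
  obtain ⟨n, hn⟩ := exists_cyl_subset hT.isTree hU hξU
  filter_upwards [(hcyl n _ (ξ.dist_root n)).mem_nhds ⟨ξ, hξ, rfl⟩] with y hy
  exact hy.mono (inter_subset_inter_right _ hn)

theorem continuous_raySupportClosed (hT : IsSphericallyHomogeneousTree T o) :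
    Continuous (raySupportClosed G : X → ClosedSubsets (Boundary T o)) := by
  refine continuous_generateFrom_iff.2 ?_
  rintro _ (⟨K, hK, rfl⟩ | ⟨U, hU, rfl⟩)
  · exact isOpen_setOf_raySupport_inter_eq_empty hT hK
  · exact isOpen_setOf_raySupport_inter_nonempty hT hU

/-- If the action is faithful and not topologically free, the ray supports are not all equal. -/
theorem not_forall_raySupportClosed_eq [CompactSpace X] (hG : IsWeaklyBranch T o G)
    [FaithfulSMul G X] (hfree : ¬ IsTopologicallyFree G X) :
    ∃ x y : X, raySupportClosed G x ≠ raySupportClosed G y := by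
  by_contra! hconst
  have hT := hG.tree
  have := faithfulSMul_boundary hT hG.level_transitive
  have : ContinuousConstSMul G (Boundary T o) := ⟨fun g => continuous_const_smul g.1⟩
  rw [IsTopologicallyFree, not_forall] at hfree
  obtain ⟨x₀, hx₀⟩ := hfree
  obtain ⟨⟨g, hg⟩, hg1⟩ := (Subgroup.ne_bot_iff_exists_ne_one).1 hx₀
  obtain ⟨W, hWg, hW, hxW⟩ := eventually_nhds_iff.1 (show ∀ᶠ y in 𝓝 x₀, g • y = y from hg)
  obtain ⟨z, U, hU, ⟨ξ, hξ⟩, hle⟩ := exists_ristDD_le_stabilizer (X := X) hG.microSupported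
    (fun h => hg1 (Subtype.ext h)) hW ⟨x₀, hxW⟩ hWg
  obtain ⟨n, hn⟩ := exists_cyl_subset hT.isTree hU hξ
  have hξz : ξ ∉ raySupport (G := G) z := fun h => h n ((ristDD_mono hn).trans hle)
  have hfix : ∀ x : X, ∃ n, x ∈ fixedByRistDD G X n (ξ.vertex n) := by
    intro x
    by_contra! h
    have hx : ξ ∈ raySupport (G := G) x := h
    have heq : raySupport (G := G) x = raySupport z := congrArg ClosedSubsets.carrier (hconst x z)
    rw [heq] at hx
    exact hξz hx
  have hmono : Monotone fun n => fixedByRistDD (T := T) (o := o) G X n (ξ.vertex n) :=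
    fun m n hmn x hx => (ristDD_mono (cyl_anti hT.isTree ξ hmn)).trans hx
  -- The clopen sets of points fixed at depth `n` along `ξ` increase with `n` and cover `X`, so one
  -- of them is all of `X`.
  obtain ⟨N, hN⟩ := isCompact_univ.elim_directed_cover _
    (fun n => (isClopen_fixedByRistDD (X := X) (G := G) hT n _ (ξ.dist_root n)).isOpen)
    (fun x _ => mem_iUnion.2 (hfix x)) hmono.directed_le
  obtain ⟨h, hh, h1⟩ := exists_mem_ristDD_ne_one hG.microSupported
    (isClopen_cyl N (ξ.vertex N)).isOpen ⟨ξ, rfl⟩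
  refine h1 (FaithfulSMul.eq_of_smul_eq_smul (α := X) fun x => ?_)
  rw [one_smul]
  exact hN (mem_univ x) hh

end SupportSet

end WeaklyBranch

theorem mainTheorem10 {V X : Type*} (T : SimpleGraph V) (o : V) (G : Subgroup (RootedAut T o))
    (hG : IsWeaklyBranch T o G)
    [TopologicalSpace X] [CompactSpace X] [T2Space X] [MulAction G X] [ContinuousConstSMul G X]
    (hX : MulAction.IsMinimal G X) :
    ¬ FaithfulSMul G X ∨
    IsTopologicallyFree G X ∨
    ∃ F : SubMulAction G (ClosedSubsets (Boundary T o)),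
      IsClosed (F : Set (ClosedSubsets (Boundary T o))) ∧
      MulAction.IsMinimal G F ∧
      Nontrivial F ∧
      (∃ π : X → F, IsFactorMap G π) ∧
      IsProfiniteGSpace G F := by
  by_cases hfaith : FaithfulSMul G X
  swap
  · exact Or.inl hfaith
  by_cases hfree : IsTopologicallyFree G X
  · exact Or.inr (Or.inl hfree)
  refine Or.inr (Or.inr ⟨raySupportSpace G X, ?_⟩)
  have hc := continuous_raySupportClosed (X := X) (G := G) hG.tree
  have hcompact : IsCompact (raySupportSpace G X : Set (ClosedSubsets (Boundary T o))) :=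
    isCompact_range hc
  have hT2 := t2Space_closedSubsets hG.tree
  let π : X → raySupportSpace (T := T) (o := o) G X := fun x => ⟨raySupportClosed G x, x, rfl⟩
  have hπ : IsFactorMap G π :=
    { continuous := hc.subtype_mk _
      map_smul := fun g x => Subtype.ext (raySupportClosed_smul g x)
      surjective := by
        rintro ⟨_, x, rfl⟩
        exact ⟨x, rfl⟩ }
  refine ⟨hcompact.isClosed, ⟨fun y => ?_⟩, ?_, ⟨π, hπ⟩,
    isProfiniteGSpace_closedSubsets hG.tree _ hcompact⟩
  · obtain ⟨x, rfl⟩ := hπ.surjective y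
    have h := hπ.surjective.denseRange.dense_image hπ.continuous (hX.dense_orbit x)
    refine h.mono ?_
    rintro _ ⟨_, ⟨g, rfl⟩, rfl⟩
    exact ⟨g, (hπ.map_smul g x).symm⟩
  · obtain ⟨x, y, hxy⟩ := not_forall_raySupportClosed_eq hG hfree
    exact ⟨π x, π y, fun h => hxy (congrArg Subtype.val h)⟩
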